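/- Let $k$ be a field, let $\bar k$ be an algebraic closure of $k$, and let $K$ be a field with $k\subseteq K\subseteq\bar k$. Let $n\ge 0$ be an integer, let $S=k[X_0,\ldots,X_n]$, and let $\mathbb{P}^n_K$ be the $n$-dimensional projective space over $K$. For a homogeneous ideal $I$ of $S$ (homogeneous with respect to the standard grading), let $\mathsf{V}_K(I)\subseteq\mathbb{P}^n_K$ be the set of all points at which every homogeneous element of $I$ vanishes (equivalently, every element of any given set of homogeneous generators of $I$). For $V\subseteq\mathbb{P}^n_K$, let $\mathsf{I}(V)$ be the ideal of $S$ generated by all homogeneous $f\in S$ that vanish at every point of $V$. For an integer $m\ge 0$, let $P_K(m)$ be the set of all homogeneous polynomials $p\in k[y_0,\ldots,y_m]$ such that every zero $(a_0,\ldots,a_m)\in K^{m+1}$ of $p$ satisfies $a_0=0$. The $K$-radical of an ideal $I$ of $S$ is $$\sqrt[K]{I}=\{f\in S:\ p(f,f_1,\ldots,f_m)\in I \text{ for some } m\ge 0,\ p\in P_K(m) \text{ and } f_1,\ldots,f_m\in S\}.$$ **Theorem (Projective Nullstellensatz for infinite fields).** Assume that $K$ is infinite. Then for any homogeneous ideal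 $I$ of $S$: 1. If $\mathsf{V}_K(I)$ is nonempty, then $\mathsf{I}(\mathsf{V}_K(I))=\sqrt[K]{I}$. 2. If $\mathsf{V}_K(I)$ is empty, then $\mathsf{I}(\mathsf{V}_K(I))=S$, and either $I=S$ or $\sqrt[K]{I}=\langle X_0,\ldots,X_n\rangle$. Additionally, if $K$ is algebraically closed: 3. If $\mathsf{V}_K(I)$ is nonempty, then $\mathsf{I}(\mathsf{V}_K(I))=\sqrt{I}$. 4. If $\mathsf{V}_K(I)$ is empty, then $\mathsf{I}(\mathsf{V}_K(I))=S$, and either $I=S$ or $\sqrt{I}=\langle X_0,\ldots,X_n\rangle$. -/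

import Mathlib

attribute [local instance] MvPolynomial.gradedAlgebra

namespace KNullstellensatz

open MvPolynomial
open scoped LinearAlgebra.Projectivization

noncomputable section

/-- `P_K(m)`: the homogeneous polynomials `p ∈ k[y_0, …, y_m]` all of whose zeros in `K ^ (m + 1)`
satisfy `y_0 = 0`. -/
def homPolysZeroImpliesFirstZero (k K : Type*) [Field k] [Field K] [Algebra k K] (m : ℕ) :
    Set (MvPolynomial (Fin (m + 1)) k) :=
  {p | (∃ d : ℕ, p.IsHomogeneous d) ∧ ∀ y : Fin (m + 1) → K, aeval y p = 0 → y 0 = 0}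

/-- The `K`-radical of an ideal `I` of `k[X_i : i ∈ σ]`: the set of all `f` such that
`p(f, f_1, …, f_m) ∈ I` for some `m ≥ 0`, `p ∈ P_K(m)` and polynomials `f_1, …, f_m`. -/
def kRadical {k : Type*} (K : Type*) [Field k] [Field K] [Algebra k K] {σ : Type*}
    (I : Ideal (MvPolynomial σ k)) : Set (MvPolynomial σ k) :=
  {f | ∃ m : ℕ, ∃ p ∈ homPolysZeroImpliesFirstZero k K m, ∃ g : Fin m → MvPolynomial σ k,
    aeval (Fin.cons f g : Fin (m + 1) → MvPolynomial σ k) p ∈ I}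

/-- `f` vanishes at the point `P` of projective space, i.e. at all homogeneous coordinate vectors
of `P`. For homogeneous `f` one coordinate vector suffices, see `vanishesAt_mk_iff`. -/
def VanishesAt {k K : Type*} [Field k] [Field K] [Algebra k K] {n : ℕ}
    (f : MvPolynomial (Fin (n + 1)) k) (P : ℙ K (Fin (n + 1) → K)) : Prop :=
  ∀ (a : Fin (n + 1) → K) (ha : a ≠ 0), Projectivization.mk K a ha = P → aeval a f = 0

/-- The zero set in `n`-dimensional projective space over `K` of a set `B` of (homogeneous)
polynomials with coefficients in `k`. -/
def projZeroSet {k : Type*} (K : Type*) [Field k] [Field K] [Algebra k K] {n : ℕ}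
    (B : Set (MvPolynomial (Fin (n + 1)) k)) : Set (ℙ K (Fin (n + 1) → K)) :=
  {P | ∀ f ∈ B, VanishesAt f P}

/-- The zero set `V_K(I)` of a homogeneous ideal `I`, computed with the set of all homogeneous
elements of `I`. Every homogeneous generating set gives the same zero set, see
`projVariety_span`. -/
def projVariety {k : Type*} (K : Type*) [Field k] [Field K] [Algebra k K] {n : ℕ}
    (I : Ideal (MvPolynomial (Fin (n + 1)) k)) : Set (ℙ K (Fin (n + 1) → K)) :=
  projZeroSet K {f | f ∈ I ∧ ∃ d : ℕ, f.IsHomogeneous d}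

/-- The vanishing ideal of a set `V` of points of projective space over `K`: the ideal of
`k[X_0, …, X_n]` generated by the homogeneous polynomials that vanish at all points of `V`. -/
def projVanishingIdeal (k : Type*) {K : Type*} [Field k] [Field K] [Algebra k K] {n : ℕ}
    (V : Set (ℙ K (Fin (n + 1) → K))) : Ideal (MvPolynomial (Fin (n + 1)) k) :=
  Ideal.span {f | (∃ d : ℕ, f.IsHomogeneous d) ∧ ∀ P ∈ V, VanishesAt f P}

theorem vanishesAt_mk_iff {k K : Type*} [Field k] [Field K] [Algebra k K] {n d : ℕ}
    {f : MvPolynomial (Fin (n + 1)) k} (hf : f.IsHomogeneous d)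
    (a : Fin (n + 1) → K) (ha : a ≠ 0) :
    VanishesAt f (Projectivization.mk K a ha) ↔ aeval a f = 0 := by
  refine ⟨fun h => h a ha rfl, fun h b hb hab => ?_⟩
  obtain ⟨c, rfl⟩ := (Projectivization.mk_eq_mk_iff' K a b ha hb).1 hab.symm
  have key : aeval (c • b) f = c ^ d * aeval b f := by
    simp only [aeval_eq_eval₂Hom, coe_eval₂Hom, eval₂_eq, Finset.mul_sum]
    refine Finset.sum_congr rfl fun e he => ?_
    have hd : ∑ i ∈ e.support, e i = d := by
      by_contra hne
      exact mem_support_iff.1 he (hf.coeff_eq_zero hne)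
    simp only [Pi.smul_apply, smul_eq_mul, mul_pow, Finset.prod_mul_distrib,
      Finset.prod_pow_eq_pow_sum, hd]
    ring
  have hc : c ≠ 0 := by
    rintro rfl
    exact ha (zero_smul _ _)
  rw [key] at h
  exact (mul_eq_zero.1 h).resolve_left (pow_ne_zero d hc)

theorem projVariety_span {k : Type*} (K : Type*) [Field k] [Field K] [Algebra k K] {n : ℕ}
    {B : Set (MvPolynomial (Fin (n + 1)) k)} (hB : ∀ f ∈ B, ∃ d : ℕ, f.IsHomogeneous d) :
    projVariety K (Ideal.span B) = projZeroSet K B := by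
  ext P
  refine ⟨fun h f hf => h f ⟨Ideal.subset_span hf, hB f hf⟩, fun h f hf a ha hP => ?_⟩
  have hle : Ideal.span B ≤ RingHom.ker (aeval (R := k) a) :=
    Ideal.span_le.2 fun g hg => h g hg a ha hP
  exact hle hf.1

end

end KNullstellensatz

namespace KNullstellensatz

open MvPolynomial
open scoped LinearAlgebra.Projectivization

/-! ### Anisotropic binary forms -/

section Anisotropic

variable {k K : Type*} [Field k] [Field K] [Algebra k K]

/-! The affine vanishing ideal of the zeros of `I` in `K` is the `K`-radical. If `K` is
algebraically closed, this is Hilbert's Nullstellensatz with `p = y_0 ^ N`. Otherwise a binary form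
`Q` over `k` has only the trivial zero in `K`, and iterating it yields `F ∈ I` with the same zeros
as `I`. For `f` vanishing on these, `Q(1 - z f, F)` has no zero in `K`, so its homogenization lies
in `P_K`; substituting `f` for the new variable, `1` for `z` and `f X_i` for `X_i` gives `f ^ D *
Q(0, F) ∈ I`.

The zero locus of a homogeneous ideal is a cone. As `K` is infinite, its vanishing ideal is
homogeneous, hence equals the projective one if the variety is nonempty. If the variety is empty and
`I ≠ ⊤`, the cone is `{0}`. -/

theorem _root_.MvPolynomial.IsHomogeneous.mem_idealOfVars {R σ : Type*} [CommRing R]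
    {p : MvPolynomial σ R} {d : ℕ} (hp : p.IsHomogeneous d) (hd : d ≠ 0) :
    p ∈ idealOfVars σ R := by
  rw [← pow_one (idealOfVars σ R), mem_pow_idealOfVars_iff']
  intro e he
  apply hp.coeff_eq_zero
  omega

theorem _root_.MvPolynomial.IsHomogeneous.aeval_smul {R A σ : Type*} [CommRing R] [CommRing A]
    [Algebra R A] {p : MvPolynomial σ R} {d : ℕ} (hp : p.IsHomogeneous d) (c : A) (a : σ → A) :
    MvPolynomial.aeval (c • a) p = c ^ d * MvPolynomial.aeval a p := by
  simp only [aeval_eq_eval₂Hom, coe_eval₂Hom, eval₂_eq, Finset.mul_sum]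
  refine Finset.sum_congr rfl fun e he => ?_
  simp only [Pi.smul_apply, smul_eq_mul, mul_pow, Finset.prod_mul_distrib,
    Finset.prod_pow_eq_pow_sum, ← hp.degree_eq_sum_deg_support he]
  ring

theorem aeval_mem_of_mem_idealOfVars {σ A : Type*} [CommRing A] [Algebra k A]
    {Q : MvPolynomial σ k} (hQ : Q ∈ idealOfVars σ k) {J : Ideal A} {x : σ → A}
    (hx : ∀ i, x i ∈ J) : aeval x Q ∈ J := by
  have : idealOfVars σ k ≤ J.comap (aeval x) := by
    rw [Ideal.span_le]
    rintro _ ⟨i, rfl⟩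
    simpa using hx i
  exact this hQ

theorem aeval_homogenize_right_zero (p : Polynomial k) (d : ℕ) (x : K) :
    aeval ![x, 0] (p.homogenize d) = algebraMap k K (p.coeff d) * x ^ d := by
  rw [Polynomial.homogenize, map_sum, Finset.sum_eq_single (d, 0)]
  · simp [aeval_monomial, Finsupp.prod_fintype]
  · rintro ⟨i, j⟩ hij hne
    have hj : j ≠ 0 := by
      rintro rfl
      exact hne (by simpa using hij)
    simp [aeval_monomial, Finsupp.prod_fintype, hj]
  · simp

/-- Over a field `K` that is algebraic over `k` and not algebraically closed, some binary form with
coefficients in `k` has only the trivial zero in `K`. -/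
theorem exists_anisotropic_binary (k K : Type*) [Field k] [Field K] [Algebra k K]
    [Algebra.IsAlgebraic k K] (hK : ¬ IsAlgClosed K) :
    ∃ Q ∈ idealOfVars (Fin 2) k, ∀ x y : K, aeval ![x, y] Q = 0 → x = 0 ∧ y = 0 := by
  obtain ⟨h, hm, hirr, hroot⟩ : ∃ h : Polynomial k, h.Monic ∧ Irreducible h ∧
      ∀ x : K, Polynomial.aeval x h ≠ 0 := by
    -- If every monic irreducible polynomial over `k` had a root in `K`, the algebraic extension `K`
    -- would be algebraically closed.
    by_contra! H
    exact hK (IsAlgClosure.of_exists_root (F := k) H).isAlgClosed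
  refine ⟨h.homogenize h.natDegree,
    (Polynomial.isHomogeneous_homogenize h).mem_idealOfVars hirr.natDegree_pos.ne', ?_⟩
  intro x y hxy
  have hy : y = 0 := by
    by_contra hy
    have hv : ![x, y] = y • ![x / y, 1] := by
      ext i
      fin_cases i <;> simp [mul_div_cancel₀ x hy]
    rw [hv, (Polynomial.isHomogeneous_homogenize h).aeval_smul,
      Polynomial.aeval_homogenize_of_eq_one le_rfl _ rfl] at hxy
    exact hroot (x / y) ((mul_eq_zero.1 hxy).resolve_left (pow_ne_zero _ hy))
  subst hy
  rw [aeval_homogenize_right_zero, hm.coeff_natDegree, map_one, one_mul] at hxy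
  exact ⟨eq_zero_of_pow_eq_zero hxy, rfl⟩

/-- If `K` is algebraic over `k` and not algebraically closed, every finitely generated ideal has
an element with the same zeros over `K`. -/
theorem exists_mem_forall_aeval_eq_zero [Algebra.IsAlgebraic k K] (hK : ¬ IsAlgClosed K)
    {σ : Type*} {I : Ideal (MvPolynomial σ k)} (hI : I.FG) :
    ∃ F ∈ I, ∀ a : σ → K, aeval a F = 0 → a ∈ zeroLocus K I := by
  obtain ⟨Q, hQ, hQ0⟩ := exists_anisotropic_binary k K hK
  induction I, hI using Submodule.fg_induction with
  | singleton x =>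
    refine ⟨x, Ideal.mem_span_singleton_self x, fun a ha p hp => ?_⟩
    obtain ⟨q, rfl⟩ := Ideal.mem_span_singleton'.1 hp
    simp [ha]
  | sup I₁ I₂ _ _ h₁ h₂ =>
    obtain ⟨F₁, hF₁, hz₁⟩ := h₁
    obtain ⟨F₂, hF₂, hz₂⟩ := h₂
    -- `Q` has no constant term, so `Q(F₁, F₂)` stays in the ideal; by anisotropy it vanishes only
    -- where both `F₁` and `F₂` do.
    refine ⟨aeval ![F₁, F₂] Q, aeval_mem_of_mem_idealOfVars hQ ?_, fun a ha p hp => ?_⟩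
    · intro i
      fin_cases i
      · exact Ideal.mem_sup_left hF₁
      · exact Ideal.mem_sup_right hF₂
    · have hcomp : (fun i => aeval a (![F₁, F₂] i)) = ![aeval a F₁, aeval a F₂] := by
        ext i; fin_cases i <;> rfl
      rw [← AlgHom.comp_apply, comp_aeval, hcomp] at ha
      obtain ⟨q₁, hq₁, q₂, hq₂, rfl⟩ := Submodule.mem_sup.1 hp
      obtain ⟨e₁, e₂⟩ := hQ0 _ _ ha
      rw [map_add, hz₁ a e₁ q₁ hq₁, hz₂ a e₂ q₂ hq₂, add_zero]

end Anisotropic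

/-! ### Homogenizing the Rabinowitsch polynomial -/

section Homogenization

variable {k : Type*} [Field k] {m : ℕ}

/-- Homogenization with respect to an additional first variable. -/
noncomputable def homogenization (E : MvPolynomial (Fin m) k) : MvPolynomial (Fin (m + 1)) k :=
  ∑ e ∈ E.support, C (coeff e E) * (X 0 ^ (E.totalDegree - e.degree) * ∏ i, X i.succ ^ e i)

theorem degree_le_totalDegree {E : MvPolynomial (Fin m) k} {e : Fin m →₀ ℕ} (he : e ∈ E.support) :
    e.degree ≤ E.totalDegree := by
  simpa [Finsupp.degree_eq_sum, Finsupp.sum_fintype] using le_totalDegree he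

theorem isHomogeneous_homogenization (E : MvPolynomial (Fin m) k) :
    (homogenization E).IsHomogeneous E.totalDegree := by
  refine IsHomogeneous.sum _ _ _ fun e he => IsHomogeneous.C_mul ?_ _
  have := (isHomogeneous_X_pow (R := k) (0 : Fin (m + 1)) (E.totalDegree - e.degree)).mul
    (IsHomogeneous.prod Finset.univ (fun i : Fin m => (X i.succ : MvPolynomial _ k) ^ e i)
      (fun i => e i) fun i _ => isHomogeneous_X_pow _ _)
  rwa [← Finsupp.degree_eq_sum, Nat.sub_add_cancel (degree_le_totalDegree he)] at this

theorem aeval_cons_homogenization {L : Type*} [Field L] [Algebra k L] (E : MvPolynomial (Fin m) k)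
    {w : L} (y : Fin m → L) (hw : w ≠ 0) :
    aeval (Fin.cons w y : Fin (m + 1) → L) (homogenization E) =
      w ^ E.totalDegree * aeval (fun i => y i / w) E := by
  rw [homogenization, aeval_eq_eval₂Hom (fun i => y i / w), coe_eval₂Hom, eval₂_eq',
    Finset.mul_sum, map_sum]
  refine Finset.sum_congr rfl fun e he => ?_
  simp only [map_mul, map_pow, map_prod, aeval_X, aeval_C, Fin.cons_zero, Fin.cons_succ, div_pow,
    Finset.prod_div_distrib, Finset.prod_pow_eq_pow_sum, ← Finsupp.degree_eq_sum]
  rw [← Nat.sub_add_cancel (degree_le_totalDegree he), pow_add, Nat.add_sub_cancel]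
  field_simp

/-- The polynomial `Q(1 - z f, F)`, where `z` is an additional first variable. -/
noncomputable def rabinowitsch (Q : MvPolynomial (Fin 2) k) (f F : MvPolynomial (Fin m) k) :
    MvPolynomial (Fin (m + 1)) k :=
  aeval ![1 - X 0 * rename Fin.succ f, rename Fin.succ F] Q

theorem aeval_rabinowitsch {L : Type*} [CommRing L] [Algebra k L] (Q : MvPolynomial (Fin 2) k)
    (f F : MvPolynomial (Fin m) k) (y : Fin (m + 1) → L) :
    aeval y (rabinowitsch Q f F) =
      aeval ![1 - y 0 * aeval (y ∘ Fin.succ) f, aeval (y ∘ Fin.succ) F] Q := by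
  rw [rabinowitsch, ← AlgHom.comp_apply, comp_aeval]
  congr 2
  ext i
  fin_cases i <;> simp [aeval_rename]

/-- Homogenizing `Q(1 - z f, F)` with `f` as the homogenizing variable gives a multiple of
`Q(0, F)`. -/
theorem aeval_homogenization_rabinowitsch (Q : MvPolynomial (Fin 2) k)
    {f : MvPolynomial (Fin m) k} (hf : f ≠ 0) (F : MvPolynomial (Fin m) k) :
    aeval (Fin.cons f (Fin.cons 1 fun i => f * X i) :
      Fin (m + 1 + 1) → MvPolynomial (Fin m) k) (homogenization (rabinowitsch Q f F)) =
        f ^ (rabinowitsch Q f F).totalDegree * aeval ![0, F] Q := by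
  -- Dehomogenizing divides by `f`, so the identity is checked in the fraction field: `z` becomes `1
  -- / f`, which kills `1 - z f`.
  let L := FractionRing (MvPolynomial (Fin m) k)
  let φ : MvPolynomial (Fin m) k →ₐ[k] L := IsScalarTower.toAlgHom k _ L
  have hφ : Function.Injective φ := IsFractionRing.injective _ _
  have hφf : φ f ≠ 0 := (map_ne_zero_iff φ hφ).2 hf
  have hcons : (fun i => φ ((Fin.cons f (Fin.cons 1 fun i => f * X i) :
      Fin (m + 1 + 1) → MvPolynomial (Fin m) k) i)) =
      Fin.cons (φ f) (fun i => φ ((Fin.cons 1 fun i => f * X i : Fin (m + 1) → _) i)) := by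
    ext i
    cases i using Fin.cases <;> rfl
  have hsucc : (fun i => φ ((Fin.cons 1 fun i => f * X i : Fin (m + 1) → _) i) / φ f) ∘ Fin.succ =
      fun i => φ (X i) := by
    ext i
    simp [hφf]
  have hX : (aeval fun i => φ (X i) : MvPolynomial (Fin m) k →ₐ[k] L) = φ := by
    ext i
    simp
  apply hφ
  rw [← AlgHom.comp_apply, comp_aeval, hcons, aeval_cons_homogenization _ _ hφf,
    aeval_rabinowitsch, hsucc, hX, map_mul, map_pow, ← AlgHom.comp_apply φ, comp_aeval]
  congr 3
  ext i
  fin_cases i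
  · simp [hφf]
  · rfl

end Homogenization

/-! ### The affine `K`-Nullstellensatz -/

section Affine

variable {k K : Type*} [Field k] [Field K] [Algebra k K]

theorem kRadical_subset_vanishingIdeal {σ : Type*} (I : Ideal (MvPolynomial σ k)) :
    kRadical K I ⊆ vanishingIdeal k (zeroLocus K I) := by
  rintro f ⟨m, p, ⟨-, hp⟩, g, hfg⟩ a ha
  have h := ha _ hfg
  rw [← AlgHom.comp_apply, comp_aeval] at h
  simpa using hp _ h

theorem pow_mem_kRadical {σ : Type*} {I : Ideal (MvPolynomial σ k)} {f : MvPolynomial σ k} {N : ℕ}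
    (h : f ^ N ∈ I) : f ∈ kRadical K I := by
  refine ⟨0, X 0 ^ N, ⟨⟨N, isHomogeneous_X_pow _ _⟩, fun y hy => ?_⟩, Fin.elim0, by simpa using h⟩
  simp only [map_pow, aeval_X] at hy
  exact eq_zero_of_pow_eq_zero hy

theorem mem_kRadical_of_not_isAlgClosed [Algebra.IsAlgebraic k K] (hK : ¬ IsAlgClosed K) {r : ℕ}
    {I : Ideal (MvPolynomial (Fin r) k)} {f : MvPolynomial (Fin r) k}
    (hf : f ∈ vanishingIdeal k (zeroLocus K I)) : f ∈ kRadical K I := by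
  obtain rfl | hf0 := eq_or_ne f 0
  · exact pow_mem_kRadical (N := 1) (by simp)
  obtain ⟨F, hFI, hF⟩ := exists_mem_forall_aeval_eq_zero (K := K) hK
    ((isNoetherianRing_iff_ideal_fg _).1 inferInstance I)
  obtain ⟨Q, hQ, hQ0⟩ := exists_anisotropic_binary k K hK
  refine ⟨r + 1, homogenization (rabinowitsch Q f F),
    ⟨⟨_, isHomogeneous_homogenization _⟩, fun y hy => ?_⟩, Fin.cons 1 fun i => f * X i, ?_⟩
  · by_contra hy0
    rw [← Fin.cons_self_tail y, aeval_cons_homogenization _ _ hy0, aeval_rabinowitsch] at hy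
    obtain ⟨h₁, h₂⟩ := hQ0 _ _ ((mul_eq_zero.1 hy).resolve_left (pow_ne_zero _ hy0))
    rw [hf _ (hF _ h₂)] at h₁
    simp at h₁
  · rw [aeval_homogenization_rabinowitsch Q hf0]
    refine I.mul_mem_left _ (aeval_mem_of_mem_idealOfVars hQ fun i => ?_)
    fin_cases i
    · exact I.zero_mem
    · exact hFI

/-- The `K`-Nullstellensatz for affine space. -/
theorem vanishingIdeal_zeroLocus_eq_kRadical [Algebra.IsAlgebraic k K] {r : ℕ}
    (I : Ideal (MvPolynomial (Fin r) k)) :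
    (vanishingIdeal k (zeroLocus K I) : Set (MvPolynomial (Fin r) k)) = kRadical K I := by
  refine (Set.Subset.antisymm (kRadical_subset_vanishingIdeal I) fun f hf => ?_).symm
  by_cases hK : IsAlgClosed K
  · rw [SetLike.mem_coe, vanishingIdeal_zeroLocus_eq_radical] at hf
    obtain ⟨N, hN⟩ := hf
    exact pow_mem_kRadical hN
  · exact mem_kRadical_of_not_isAlgClosed hK hf

end Affine

/-! ### Cones and projective varieties -/

section Projective

variable {k K : Type*} [Field k] [Field K] [Algebra k K] {n : ℕ}
  {I : Ideal (MvPolynomial (Fin (n + 1)) k)}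

theorem mk_mem_projVariety_iff (hI : I.IsHomogeneous (homogeneousSubmodule (Fin (n + 1)) k))
    (a : Fin (n + 1) → K) (ha : a ≠ 0) :
    Projectivization.mk K a ha ∈ projVariety K I ↔ a ∈ zeroLocus K I := by
  constructor
  · intro h f hf
    rw [← sum_homogeneousComponent f, map_sum]
    exact Finset.sum_eq_zero fun i _ => h _ ⟨homogeneousComponent_mem_of_mem hI hf i, i,
      homogeneousComponent_isHomogeneous i f⟩ a ha rfl
  · rintro h f ⟨hf, d, hd⟩
    exact (vanishesAt_mk_iff hd a ha).2 (h f hf)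

theorem smul_mem_zeroLocus (hI : I.IsHomogeneous (homogeneousSubmodule (Fin (n + 1)) k))
    {a : Fin (n + 1) → K} (ha : a ∈ zeroLocus K I) (c : K) : c • a ∈ zeroLocus K I := by
  intro f hf
  rw [← sum_homogeneousComponent f, map_sum]
  refine Finset.sum_eq_zero fun i _ => ?_
  rw [(homogeneousComponent_isHomogeneous i f).aeval_smul,
    ha _ (homogeneousComponent_mem_of_mem hI hf i), mul_zero]

/-- Over an infinite field, the homogeneous components of a polynomial that vanishes on a cone
vanish on the cone. -/
theorem homogeneousComponent_mem_vanishingIdeal [Infinite K] {V : Set (Fin (n + 1) → K)}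
    (hV : ∀ a ∈ V, ∀ c : K, c • a ∈ V) {f : MvPolynomial (Fin (n + 1)) k}
    (hf : f ∈ vanishingIdeal k V) (d : ℕ) : homogeneousComponent d f ∈ vanishingIdeal k V := by
  intro a ha
  -- `q(c) = f(c • a)` vanishes for all `c` in the infinite field `K`, so every coefficient of `q`
  -- is zero.
  let q : Polynomial K := ∑ i ∈ Finset.range (f.totalDegree + 1),
    Polynomial.monomial i (aeval a (homogeneousComponent i f))
  have hq : q = 0 := by
    refine Polynomial.funext fun c => ?_
    have h := hf _ (hV a ha c)
    rw [← sum_homogeneousComponent f, map_sum] at h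
    rw [Polynomial.eval_zero, ← h, Polynomial.eval_finsetSum]
    refine Finset.sum_congr rfl fun i _ => ?_
    rw [(homogeneousComponent_isHomogeneous i f).aeval_smul, Polynomial.eval_monomial, mul_comm]
  rcases lt_or_ge f.totalDegree d with hd | hd
  · rw [homogeneousComponent_eq_zero _ _ hd, map_zero]
  · have h := congrArg (Polynomial.coeff · d) hq
    simpa [q, Polynomial.finsetSum_coeff, Polynomial.coeff_monomial, Nat.lt_succ_iff, hd,
      not_lt.2 hd] using h

theorem projVanishingIdeal_projVariety [Infinite K]
    (hI : I.IsHomogeneous (homogeneousSubmodule (Fin (n + 1)) k))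
    (hne : (projVariety K I).Nonempty) :
    projVanishingIdeal k (projVariety K I) = vanishingIdeal k (zeroLocus K I) := by
  obtain ⟨P, hP⟩ := hne
  induction P using Projectivization.ind with | h b hb
  rw [mk_mem_projVariety_iff hI] at hP
  apply le_antisymm
  · refine Ideal.span_le.2 ?_
    rintro f ⟨⟨d, hd⟩, hf⟩ a ha
    have hf' : ∀ a ∈ zeroLocus K I, a ≠ 0 → aeval a f = 0 := fun a ha ha0 =>
      hf _ ((mk_mem_projVariety_iff hI a ha0).2 ha) a ha0 rfl
    by_cases ha0 : a = 0
    · rw [ha0, ← zero_smul K b, hd.aeval_smul, hf' b hP hb, mul_zero]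
    · exact hf' a ha ha0
  · intro f hf
    rw [← sum_homogeneousComponent f]
    refine Ideal.sum_mem _ fun i _ => Ideal.subset_span
      ⟨⟨i, homogeneousComponent_isHomogeneous i f⟩, fun Q hQ a ha hQa => ?_⟩
    subst hQa
    exact homogeneousComponent_mem_vanishingIdeal (fun a ha c => smul_mem_zeroLocus hI ha c) hf i a
      ((mk_mem_projVariety_iff hI a ha).1 hQ)

theorem projVanishingIdeal_empty :
    projVanishingIdeal k (∅ : Set (ℙ K (Fin (n + 1) → K))) = ⊤ :=
  (Ideal.eq_top_iff_one _).2 (Ideal.subset_span ⟨⟨0, isHomogeneous_one _ _⟩, by simp⟩)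

theorem vanishingIdeal_singleton_zero :
    vanishingIdeal k {(0 : Fin (n + 1) → K)} = idealOfVars (Fin (n + 1)) k := by
  ext f
  rw [mem_vanishingIdeal_singleton_iff, ← pow_one (idealOfVars _ _), mem_pow_idealOfVars_iff']
  simp [aeval_zero, constantCoeff_eq, Finsupp.degree_eq_zero_iff]

/-- The constant term of an element of `I` is its degree-zero component, so it lies in `I` and would
be a unit if nonzero. -/
theorem le_idealOfVars_of_ne_top (hI : I.IsHomogeneous (homogeneousSubmodule (Fin (n + 1)) k))
    (h : I ≠ ⊤) : I ≤ idealOfVars (Fin (n + 1)) k := by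
  intro f hf
  rw [← pow_one (idealOfVars _ _), mem_pow_idealOfVars_iff']
  intro e he
  obtain rfl : e = 0 := (Finsupp.degree_eq_zero_iff e).1 (Nat.lt_one_iff.1 he)
  by_contra h0
  have := homogeneousComponent_mem_of_mem hI hf 0
  rw [homogeneousComponent_zero] at this
  exact h (Ideal.eq_top_of_isUnit_mem _ this ((IsUnit.mk0 _ h0).map C))

theorem vanishingIdeal_zeroLocus_of_projVariety_eq_empty
    (hI : I.IsHomogeneous (homogeneousSubmodule (Fin (n + 1)) k)) (he : projVariety K I = ∅)
    (h : I ≠ ⊤) : vanishingIdeal k (zeroLocus K I) = Ideal.span (Set.range X) := by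
  have hz : zeroLocus K I = {0} := by
    ext a
    constructor
    · intro ha
      by_contra ha0
      have := (mk_mem_projVariety_iff hI a ha0).2 ha
      simp [he] at this
    · rintro rfl f hf
      have := le_idealOfVars_of_ne_top hI h hf
      rw [← vanishingIdeal_singleton_zero (K := K)] at this
      exact this 0 rfl
  rw [hz, vanishingIdeal_singleton_zero]

end Projective

end KNullstellensatz

theorem mainTheorem3 {k K : Type*} [Field k] [Field K] [Algebra k K] [Algebra.IsAlgebraic k K]
    [Infinite K] (n : ℕ) (I : Ideal (MvPolynomial (Fin (n + 1)) k))
    (hI : I.IsHomogeneous (MvPolynomial.homogeneousSubmodule (Fin (n + 1)) k)) :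
    ((KNullstellensatz.projVariety K I).Nonempty →
      (KNullstellensatz.projVanishingIdeal k (KNullstellensatz.projVariety K I) : Set (MvPolynomial (Fin (n + 1)) k)) =
        KNullstellensatz.kRadical K I) ∧
    (KNullstellensatz.projVariety K I = ∅ →
      KNullstellensatz.projVanishingIdeal k (KNullstellensatz.projVariety K I) = ⊤ ∧
      (I = ⊤ ∨ KNullstellensatz.kRadical K I =
        (Ideal.span (Set.range MvPolynomial.X) : Ideal (MvPolynomial (Fin (n + 1)) k)))) ∧
    (IsAlgClosed K →
      ((KNullstellensatz.projVariety K I).Nonempty →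
        KNullstellensatz.projVanishingIdeal k (KNullstellensatz.projVariety K I) = I.radical) ∧
      (KNullstellensatz.projVariety K I = ∅ →
        KNullstellensatz.projVanishingIdeal k (KNullstellensatz.projVariety K I) = ⊤ ∧
        (I = ⊤ ∨ I.radical = Ideal.span (Set.range MvPolynomial.X)))) := by
  have hrad := KNullstellensatz.vanishingIdeal_zeroLocus_eq_kRadical (K := K) I
  refine ⟨fun hne => ?_, fun he => ⟨?_, ?_⟩, fun _ => ⟨fun hne => ?_, fun he => ⟨?_, ?_⟩⟩⟩
  · rw [KNullstellensatz.projVanishingIdeal_projVariety hI hne, hrad]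
  · rw [he, KNullstellensatz.projVanishingIdeal_empty]
  · refine or_iff_not_imp_left.2 fun h => ?_
    rw [← hrad, KNullstellensatz.vanishingIdeal_zeroLocus_of_projVariety_eq_empty hI he h]
  · rw [KNullstellensatz.projVanishingIdeal_projVariety hI hne,
      MvPolynomial.vanishingIdeal_zeroLocus_eq_radical]
  · rw [he, KNullstellensatz.projVanishingIdeal_empty]
  · refine or_iff_not_imp_left.2 fun h => ?_
    rw [← MvPolynomial.vanishingIdeal_zeroLocus_eq_radical (K := K),
      KNullstellensatz.vanishingIdeal_zeroLocus_of_projVariety_eq_empty hI he h]
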